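/- Let $H$ be a complex Hilbert space and $\rho>0$. Let $C_\rho(H)$ be the set of bounded operators $T$ on $H$ admitting a unitary $\rho$-dilation: there are a Hilbert space $\mathcal H$ containing $H$ as a closed subspace and a unitary operator $U$ on $\mathcal H$ such that $T^k=\rho P_H U^k|_H$ for all integers $k\ge 1$, where $P_H$ is the orthogonal projection of $\mathcal H$ onto $H$. Put $w_\rho(T)=\inf\{\gamma>0:\gamma^{-1}T\in C_\rho(H)\}$. For $T_0,T_1\in C_\rho(H)$, say that $T_1$ is Harnack dominated by $T_0$ if there is a constant $c\ge 1$ such that $$\operatorname{Re} p(T_1)\le c^2\operatorname{Re} p(T_0)+(c^2-1)(\rho-1)\operatorname{Re} p(0_H)$$ for every complex polynomial $p$ with $\operatorname{Re} p\ge 0$ on the closed unit disc, where $\operatorname{Re} A=\frac12(A+A^*)$ for an operator $A$; say that $T_0$ and $T_1$ are Harnack equivalent if each is Harnack dominated by the other. For $b \in \mathbb C$ let $S_{n+1}(b)$ be the operator on $\mathbb C^{n+1}$ whose matrix in the canonical basis has all entries of the first superdiagonal equal to $b$ and all other entries equal to $0$, and let $S=S_{n+1}(a)$ with $a=w_\rho(S_{n+1}(1))^{-1}$.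 **Proposition.** Let $\rho>1$ and let $n+1$ be an even number, i.e. $n=2p-1$ with $p\ge 1$. If $T\in C_\rho(\mathbb C^{n+1})$ is Harnack equivalent to $S$, then $T$ is irreducible: the only subspaces $E$ of $\mathbb C^{n+1}$ such that both $E$ and $E^\perp$ are invariant under $T$ are $\{0\}$ and $\mathbb C^{n+1}$. -/

import Mathlib

open scoped ComplexStarModule

universe u

/-- `T` is a `ρ`-contraction (`T ∈ C_ρ(H)`): there are a Hilbert space `K`, an isometric embedding
`J : H → K` (which identifies `H` with a closed subspace of `K`) and a unitary operator `U` on `K`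
with `T ^ n = ρ P_H U ^ n | H` for all `n ≥ 1`. Compressing an operator `A` on `K` to `H` is
`J† A J`, since `J J†` is the orthogonal projection onto the copy of `H`.
Taking `K` in the universe of `H` is no restriction, since the closed linear span of all
`U ^ n (J H)`, `n ∈ ℤ`, is already such a space. -/
def IsRhoContraction {H : Type u} [NormedAddCommGroup H] [InnerProductSpace ℂ H] [CompleteSpace H]
    (ρ : ℝ) (T : H →L[ℂ] H) : Prop :=
  ∃ (K : Type u) (_ : NormedAddCommGroup K) (_ : InnerProductSpace ℂ K) (_ : CompleteSpace K)
    (J : H →ₗᵢ[ℂ] K) (U : K →L[ℂ] K),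
    U ∈ unitary (K →L[ℂ] K) ∧
    ∀ n : ℕ, 1 ≤ n →
      T ^ n = (ρ : ℂ) • ((ContinuousLinearMap.adjoint J.toContinuousLinearMap).comp
        ((U ^ n).comp J.toContinuousLinearMap))

/-- The `ρ`-numerical radius `w_ρ(T) = inf {γ > 0 : γ⁻¹ T ∈ C_ρ(H)}`. -/
noncomputable def rhoNumericalRadius {H : Type u} [NormedAddCommGroup H] [InnerProductSpace ℂ H]
    [CompleteSpace H] (ρ : ℝ) (T : H →L[ℂ] H) : ℝ :=
  sInf {γ : ℝ | 0 < γ ∧ IsRhoContraction ρ (((γ⁻¹ : ℝ) : ℂ) • T)}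

/-- `T₁` is Harnack dominated by `T₀` (for operators in `C_ρ(H)`): for some constant `c ≥ 1`,
`Re p(T₁) ≤ c² Re p(T₀) + (c² - 1)(ρ - 1) Re p(0)` in the operator order, for every
complex polynomial `p` with `Re p ≥ 0` on the closed unit disc.
Here `ℜ A = (A + A†) / 2`. -/
def HarnackDominated {H : Type u} [NormedAddCommGroup H] [InnerProductSpace ℂ H] [CompleteSpace H]
    (ρ : ℝ) (T₁ T₀ : H →L[ℂ] H) : Prop :=
  ∃ c : ℝ, 1 ≤ c ∧ ∀ p : Polynomial ℂ,
    (∀ z : ℂ, ‖z‖ ≤ 1 → 0 ≤ (p.eval z).re) →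
      ((ℜ (Polynomial.aeval T₁ p) : H →L[ℂ] H)) ≤
        ((c ^ 2 : ℝ) : ℂ) • (ℜ (Polynomial.aeval T₀ p) : H →L[ℂ] H) +
        (((c ^ 2 - 1) * (ρ - 1) : ℝ) : ℂ) •
          (ℜ (Polynomial.aeval (0 : H →L[ℂ] H) p) : H →L[ℂ] H)

/-- Harnack equivalence: each operator is Harnack dominated by the other. -/
def HarnackEquivalent {H : Type u} [NormedAddCommGroup H] [InnerProductSpace ℂ H] [CompleteSpace H]
    (ρ : ℝ) (T₁ T₀ : H →L[ℂ] H) : Prop :=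
  HarnackDominated ρ T₁ T₀ ∧ HarnackDominated ρ T₀ T₁

/-- The truncated shift `S_m(b)` on `ℂ ^ m`: entries `b` on the first superdiagonal, `0`
elsewhere. -/
noncomputable def truncatedShift (m : ℕ) (b : ℂ) :
    EuclideanSpace ℂ (Fin m) →L[ℂ] EuclideanSpace ℂ (Fin m) :=
  Matrix.toEuclideanCLM (n := Fin m) (𝕜 := ℂ)
    (Matrix.of fun i j : Fin m => if (i : ℕ) + 1 = (j : ℕ) then b else 0)

/-- The `w_ρ`-normalized truncated shift `S_m(a)`, `a = w_ρ(S_m(1))⁻¹`, on `ℂ ^ m`. -/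
noncomputable def normalizedTruncatedShift (ρ : ℝ) (m : ℕ) :
    EuclideanSpace ℂ (Fin m) →L[ℂ] EuclideanSpace ℂ (Fin m) :=
  truncatedShift m (((rhoNumericalRadius ρ (truncatedShift m 1))⁻¹ : ℝ) : ℂ)

/-- `T` is irreducible: its only reducing subspaces (closed subspaces `E` such that `E` and its
orthogonal complement are both invariant under `T`) are `0` and the whole space. -/
def IsIrreducibleOperator {H : Type u} [NormedAddCommGroup H] [InnerProductSpace ℂ H]
    (T : H →L[ℂ] H) : Prop :=
  ∀ E : Submodule ℂ H, IsClosed (E : Set H) →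
    (∀ x ∈ E, T x ∈ E) → (∀ x ∈ Eᗮ, T x ∈ Eᗮ) → E = ⊥ ∨ E = ⊤

/-! Write `m = n + 1`, `b = a`, and let `Q` be the form of the Toeplitz matrix `ρ I + ∑ b ^ k (N ^ k
+ N† ^ k)`. For a shift, membership in `C_ρ` means `Q ≥ 0`, and normalization by `w_ρ` makes `Q`
degenerate. Since `ρ ≠ 1` and `b ≠ 0`, a null vector is determined by its first entry. For even `m`,
a nonzero null vector `x` has no zero entry: a zero at `j` would give an antisymmetric null vector
of size `2 j + 1`, and after a reflection if necessary this size is less than `m`, which positivity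
forbids (`IsShiftNull.ne_zero`).

Harnack equivalence makes the Fejér sums of `T` and `S` comparable at every point `z` of the circle.
Divided by `N`, those of `S` tend to `Q` conjugated by the diagonal unitary `twist z`, whose null
line is spanned by `twist z x`. If `E` reduces `T`, the Fejér sums of `T` split along `E` and `Eᗮ`
into nonnegative parts. The `E`-component of `twist z x` is therefore null too, so it is a multiple
of `twist z x`, and `twist z x` lies in `E` or in `Eᗮ`
(`HarnackEquivalent.twist_mem_or_mem_orthogonal`).

One of the two contains `twist z x` for infinitely many `z`. As no entry of `x` vanishes, these
vectors span the whole space. -/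

open Filter Topology ComplexConjugate

/-! ### Null vectors of the Toeplitz sections -/

/-- The entries of the Toeplitz matrix `ρ I + ∑_{k ≥ 1} b ^ k (N ^ k + N† ^ k)`, `N` the shift. -/
noncomputable def shiftKernel (ρ b : ℂ) (i j : ℕ) : ℂ :=
  if i = j then ρ else b ^ ((i - j) + (j - i))

theorem shiftKernel_comm (ρ b : ℂ) (i j : ℕ) : shiftKernel ρ b i j = shiftKernel ρ b j i := by
  unfold shiftKernel
  simp only [eq_comm, add_comm]

theorem shiftKernel_reflect (ρ b : ℂ) {m i j : ℕ} (hi : i ≤ m) (hj : j ≤ m) :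
    shiftKernel ρ b (m - i) (m - j) = shiftKernel ρ b i j := by
  unfold shiftKernel
  have h1 : (m - i = m - j) ↔ i = j := by omega
  have h2 : (m - i - (m - j)) + (m - j - (m - i)) = (i - j) + (j - i) := by omega
  simp only [h1, h2]

theorem shiftKernel_self (ρ b : ℂ) (i : ℕ) : shiftKernel ρ b i i = ρ := by
  simp [shiftKernel]

theorem shiftKernel_of_lt (ρ b : ℂ) {i j : ℕ} (h : i < j) : shiftKernel ρ b i j = b ^ (j - i) := by
  unfold shiftKernel
  rw [if_neg h.ne, Nat.sub_eq_zero_of_le h.le, zero_add]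

/-- The first `m` terms of `v` form a null vector of the `m × m` section of the kernel. -/
def IsShiftNull (ρ b : ℂ) (m : ℕ) (v : ℕ → ℂ) : Prop :=
  ∀ i < m, ∑ k ∈ Finset.range m, shiftKernel ρ b i k * v k = 0

/-- In `b` times row `i + 1` minus row `i`, the geometric terms with `k > i + 1` cancel. If all
earlier entries vanish, only `(ρ - 1) b v (i + 1)` remains. -/
theorem IsShiftNull.eq_zero_of_zero {ρ b : ℂ} {m : ℕ} {v : ℕ → ℂ} (hρ : ρ ≠ 1) (hb : b ≠ 0)
    (h : IsShiftNull ρ b m v) (h0 : v 0 = 0) : ∀ i < m, v i = 0 := by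
  intro i
  induction i using Nat.strong_induction_on with
  | _ i ih =>
    intro hi
    rcases i with _ | i
    · exact h0
    have e1 := h i (by omega)
    have e2 := h (i + 1) hi
    have e3 : ∑ k ∈ Finset.range m, (b * (shiftKernel ρ b (i + 1) k * v k) -
        shiftKernel ρ b i k * v k) =
        ∑ k ∈ Finset.range m, if k = i + 1 then (ρ - 1) * b * v (i + 1) else 0 := by
      refine Finset.sum_congr rfl fun k hk => ?_
      rw [Finset.mem_range] at hk
      rcases lt_trichotomy k (i + 1) with hlt | rfl | hgt
      · rw [ih k hlt hk, if_neg hlt.ne]; simp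
      · rw [if_pos rfl, shiftKernel_self, shiftKernel_of_lt _ _ (Nat.lt_succ_self i)]
        simp; ring
      · rw [if_neg hgt.ne', shiftKernel_of_lt _ _ hgt, shiftKernel_of_lt _ _ (by omega),
          show k - i = k - (i + 1) + 1 by omega]
        ring
    rw [Finset.sum_sub_distrib, ← Finset.mul_sum, e1, e2, Finset.sum_ite_eq',
      if_pos (Finset.mem_range.2 hi)] at e3
    have : (ρ - 1) * b * v (i + 1) = 0 := by rw [← e3]; simp
    simpa [sub_eq_zero, hρ, hb] using this

theorem IsShiftNull.reflect {ρ b : ℂ} {m : ℕ} {v : ℕ → ℂ} (h : IsShiftNull ρ b m v) :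
    IsShiftNull ρ b m fun k => v (m - 1 - k) := by
  intro i hi
  rw [← h (m - 1 - i) (by omega), ← Finset.sum_range_reflect]
  refine Finset.sum_congr rfl fun k hk => ?_
  rw [Finset.mem_range] at hk
  have e : m - 1 - (m - 1 - k) = k := by omega
  simp only [e]
  rw [← shiftKernel_reflect ρ b (m := m - 1) (i := i) (j := m - 1 - k) (by omega) (by omega), e]

theorem IsShiftNull.eq_zero_of_last {ρ b : ℂ} {m : ℕ} {v : ℕ → ℂ} (hρ : ρ ≠ 1) (hb : b ≠ 0)
    (h : IsShiftNull ρ b m v) (h0 : v (m - 1) = 0) : ∀ i < m, v i = 0 := by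
  intro i hi
  have := h.reflect.eq_zero_of_zero hρ hb (by simpa using h0) (m - 1 - i) (by omega)
  rwa [show m - 1 - (m - 1 - i) = i by omega] at this

/-- A null vector vanishing at `j` yields an antisymmetric null vector of size `2 j + 1`. -/
theorem IsShiftNull.antisymm {ρ b : ℂ} {m j : ℕ} {v : ℕ → ℂ} (h : IsShiftNull ρ b m v)
    (hj : j < m) (h0 : v j = 0) :
    IsShiftNull ρ b (2 * j + 1) fun k => if k < j then v k else - v (2 * j - k) := by
  set u : ℕ → ℂ := fun k => if k < j then v k else - v (2 * j - k) with hu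
  obtain ⟨r, rfl⟩ : ∃ r, m = j + 1 + r := ⟨m - (j + 1), by omega⟩
  -- Every row `i ≤ j` sees the entries beyond `j` only through `b ^ (j - i) * R`. Row `j` shows
  -- that the negated mirror image of the first `j` entries produces the same `R`, so it can replace
  -- the true tail.
  set R : ℂ := ∑ l ∈ Finset.range r, b ^ (l + 1) * v (j + 1 + l) with hR
  have row : ∀ i ≤ j, (∑ k ∈ Finset.range j, shiftKernel ρ b i k * v k) + b ^ (j - i) * R = 0 := by
    intro i hi
    have := h i (by omega)
    rw [Finset.sum_range_add, Finset.sum_range_succ, h0, mul_zero, add_zero] at this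
    rw [← this, hR, Finset.mul_sum]
    congr 1
    refine Finset.sum_congr rfl fun l _ => ?_
    rw [shiftKernel_of_lt _ _ (by omega), show j + 1 + l - i = (j - i) + (l + 1) by omega]
    ring
  have hL : (∑ k ∈ Finset.range j, b ^ (j - k) * v k) = - R := by
    have := row j le_rfl
    rw [Nat.sub_self, pow_zero, one_mul] at this
    rw [← eq_neg_of_add_eq_zero_left this]
    refine Finset.sum_congr rfl fun k hk => ?_
    rw [shiftKernel_comm, shiftKernel_of_lt _ _ (Finset.mem_range.1 hk)]
  have low : ∀ i ≤ j, ∑ k ∈ Finset.range (2 * j + 1), shiftKernel ρ b i k * u k = 0 := by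
    intro i hi
    rw [show 2 * j + 1 = j + 1 + j by ring, Finset.sum_range_add, Finset.sum_range_succ]
    have hj0 : u j = 0 := by simp [hu, show 2 * j - j = j by omega, h0]
    rw [hj0, mul_zero, add_zero, ← row i hi]
    congr 1
    · refine Finset.sum_congr rfl fun k hk => ?_
      simp [hu, Finset.mem_range.1 hk]
    · rw [← neg_neg R, ← hL, ← Finset.sum_range_reflect, ← Finset.sum_neg_distrib, Finset.mul_sum]
      refine Finset.sum_congr rfl fun k hk => ?_
      rw [Finset.mem_range] at hk
      rw [shiftKernel_of_lt _ _ (by omega)]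
      simp only [hu]
      rw [if_neg (by omega), show 2 * j - (j + 1 + (j - 1 - k)) = k by omega,
        show j + 1 + (j - 1 - k) - i = (j - i) + (j - k) by omega]
      ring
  intro i hi
  rcases le_or_gt i j with hij | hij
  · exact low i hij
  have hl := low (2 * j - i) (by omega)
  rw [← Finset.sum_range_reflect] at hl
  rw [← neg_eq_zero, ← Finset.sum_neg_distrib, ← hl]
  refine Finset.sum_congr rfl fun k hk => ?_
  rw [Finset.mem_range] at hk
  rw [show 2 * j + 1 - 1 - k = 2 * j - k by omega, shiftKernel_reflect _ _ (by omega) (by omega),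
    ← mul_neg]
  congr 1
  simp only [hu]
  rcases lt_trichotomy k j with hkj | rfl | hkj
  · rw [if_pos hkj, if_neg (by omega), show 2 * j - (2 * j - k) = k by omega]
  · simp [show 2 * k - k = k by omega, h0]
  · rw [if_neg (by omega), if_pos (by omega), neg_neg]

/-- The `m × m` section of the kernel. -/
noncomputable def shiftKernelMatrix (m : ℕ) (ρ b : ℝ) : Matrix (Fin m) (Fin m) ℂ :=
  Matrix.of fun i j => shiftKernel ρ b i j

open Matrix in
theorem isShiftNull_iff {m : ℕ} {ρ b : ℝ} {v : ℕ → ℂ} :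
    IsShiftNull ρ b m v ↔ shiftKernelMatrix m ρ b *ᵥ (fun i : Fin m => v i) = 0 := by
  constructor
  · intro h
    ext i
    rw [Matrix.mulVec, dotProduct]
    exact (Fin.sum_univ_eq_sum_range (fun k => shiftKernel ρ b i k * v k) m).trans (h i i.2)
  · intro h i hi
    have := congrFun h ⟨i, hi⟩
    rw [Matrix.mulVec, dotProduct] at this
    exact (Fin.sum_univ_eq_sum_range (fun k => shiftKernel ρ b i k * v k) m).symm.trans this

-- Extended by zero, `v` annihilates the full form, hence is a null vector of the full matrix by
-- positivity. Its last entry is zero, which forces it to vanish.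
open scoped ComplexOrder in
open Matrix in
theorem IsShiftNull.eq_zero_of_lt {m l : ℕ} {ρ b : ℝ} {v : ℕ → ℂ} (hρ : ρ ≠ 1) (hb : b ≠ 0)
    (hM : (shiftKernelMatrix m ρ b).PosSemidef) (hl : l < m) (h : IsShiftNull ρ b l v) :
    ∀ i < l, v i = 0 := by
  set w : ℕ → ℂ := fun k => if k < l then v k else 0 with hw
  have key : ∀ i < l, ∑ k ∈ Finset.range m, shiftKernel ρ b i k * w k = 0 := by
    intro i hi
    obtain ⟨r, rfl⟩ : ∃ r, m = l + r := ⟨m - l, by omega⟩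
    rw [Finset.sum_range_add, ← h i hi]
    conv_rhs => rw [← add_zero (∑ k ∈ Finset.range l, shiftKernel ρ b i k * v k)]
    congr 1
    · exact Finset.sum_congr rfl fun k hk => by simp [hw, Finset.mem_range.1 hk]
    · exact Finset.sum_eq_zero fun k _ => by simp [hw]
  have hq : star (fun i : Fin m => w i) ⬝ᵥ (shiftKernelMatrix m ρ b *ᵥ fun i : Fin m => w i) = 0 := by
    rw [dotProduct]
    refine Finset.sum_eq_zero fun i _ => ?_
    by_cases hi : (i : ℕ) < l
    · have e : (shiftKernelMatrix m ρ b *ᵥ fun i : Fin m => w i) i = 0 := by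
        rw [Matrix.mulVec, dotProduct]
        exact (Fin.sum_univ_eq_sum_range (fun k => shiftKernel ρ b i k * w k) m).trans (key i hi)
      rw [e, mul_zero]
    · simp [hw, hi]
  have hn : IsShiftNull ρ b m w := isShiftNull_iff.2 ((hM.dotProduct_mulVec_zero_iff _).1 hq)
  have hz := hn.eq_zero_of_last (by exact_mod_cast hρ) (by exact_mod_cast hb)
    (by simp only [hw]; rw [if_neg (by omega)])
  intro i hi
  simpa [hw, hi] using hz i (by omega)

open scoped ComplexOrder in
/-- In even size, a nonzero null vector of a positive semidefinite section has no zero entry. -/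
theorem IsShiftNull.ne_zero {m : ℕ} {ρ b : ℝ} {v : ℕ → ℂ} (hρ : ρ ≠ 1) (hb : b ≠ 0)
    (hM : (shiftKernelMatrix m ρ b).PosSemidef) (hm : Even m) (h : IsShiftNull ρ b m v)
    (hv : ∃ i < m, v i ≠ 0) : ∀ j < m, v j ≠ 0 := by
  have hρ' : (ρ : ℂ) ≠ 1 := by exact_mod_cast hρ
  have hb' : (b : ℂ) ≠ 0 := by exact_mod_cast hb
  have main : ∀ w : ℕ → ℂ, IsShiftNull ρ b m w → ∀ j, 2 * j + 1 < m → w j = 0 →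
      ∀ i < m, w i = 0 := by
    intro w hw j hj h0
    refine hw.eq_zero_of_zero hρ' hb' ?_
    have := (hw.antisymm (j := j) (by omega) h0).eq_zero_of_lt hρ hb hM hj 0 (by omega)
    rcases Nat.eq_zero_or_pos j with rfl | hj0
    · exact h0
    · simpa [hj0] using this
  intro j hj h0
  obtain ⟨i, hi, hvi⟩ := hv
  obtain ⟨p, hp⟩ := hm
  -- Evenness excludes `2 * j + 1 = m`, so either `j` or its mirror image `m - 1 - j` lies strictly
  -- in the first half.
  by_cases hlt : 2 * j + 1 < m
  · exact hvi (main v h j hlt h0 i hi)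
  · have := main _ h.reflect (m - 1 - j) (by omega)
      (by simpa [show m - 1 - (m - 1 - j) = j by omega] using h0) (m - 1 - i) (by omega)
    rw [show m - 1 - (m - 1 - i) = i by omega] at this
    exact hvi this

/-! ### Fejér sums and Harnack domination -/

/-- `N` times the `N`-th Fejér mean of the trigonometric series `a + 2 ∑ c k cos ((k + 1) t)`
at `t = 0`. -/
noncomputable def fejerSum (a : ℝ) (c : ℕ → ℝ) (N : ℕ) : ℝ :=
  N * a + 2 * ∑ k ∈ Finset.range N, ((N : ℝ) - 1 - k) * c k

theorem fejerSum_succ (a : ℝ) (c : ℕ → ℝ) (N : ℕ) :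
    fejerSum a c (N + 1) = fejerSum a c N + (a + 2 * ∑ k ∈ Finset.range N, c k) := by
  unfold fejerSum
  rw [Finset.sum_range_succ]
  have : ∑ k ∈ Finset.range N, (((N + 1 : ℕ) : ℝ) - 1 - k) * c k =
      ∑ k ∈ Finset.range N, ((N : ℝ) - 1 - k) * c k + ∑ k ∈ Finset.range N, c k := by
    rw [← Finset.sum_add_distrib]
    refine Finset.sum_congr rfl fun k _ => ?_
    push_cast; ring
  rw [this]
  push_cast; ring

theorem fejerSum_mul (r a : ℝ) (c : ℕ → ℝ) (N : ℕ) :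
    fejerSum (r * a) (fun k => r * c k) N = r * fejerSum a c N := by
  unfold fejerSum
  rw [mul_add, mul_left_comm r 2, Finset.mul_sum (a := r)]
  congr 1
  · ring
  · congr 1
    exact Finset.sum_congr rfl fun k _ => by ring

theorem tendsto_fejerSum_div (a : ℝ) {c : ℕ → ℝ} {m : ℕ} (hc : ∀ k, m ≤ k → c k = 0) :
    Tendsto (fun N : ℕ => fejerSum a c N / N) atTop (𝓝 (a + 2 * ∑ k ∈ Finset.range m, c k)) := by
  have h1 : Tendsto (fun N : ℕ => (a + 2 * ∑ k ∈ Finset.range m, c k) -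
      (2 * ∑ k ∈ Finset.range m, (1 + (k : ℝ)) * c k) / N) atTop
      (𝓝 ((a + 2 * ∑ k ∈ Finset.range m, c k) - 0)) :=
    tendsto_const_nhds.sub (tendsto_const_div_atTop_nhds_zero_nat _)
  rw [sub_zero] at h1
  refine h1.congr' ?_
  filter_upwards [eventually_ge_atTop (m + 1)] with N hN
  have hN0 : (N : ℝ) ≠ 0 := by
    have : N ≠ 0 := by omega
    exact_mod_cast this
  have e : ∑ k ∈ Finset.range N, ((N : ℝ) - 1 - k) * c k =
      ∑ k ∈ Finset.range m, ((N : ℝ) - 1 - k) * c k := by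
    symm
    refine Finset.sum_subset (Finset.range_subset_range.2 (by omega)) fun k _ hk => ?_
    rw [hc k (by simpa using hk), mul_zero]
  have e2 : ∑ k ∈ Finset.range m, ((N : ℝ) - 1 - k) * c k =
      N * ∑ k ∈ Finset.range m, c k - ∑ k ∈ Finset.range m, (1 + (k : ℝ)) * c k := by
    rw [Finset.mul_sum, ← Finset.sum_sub_distrib]
    exact Finset.sum_congr rfl fun k _ => by ring
  unfold fejerSum
  rw [e, e2]
  field_simp
  ring

section Moments

variable {H : Type*} [NormedAddCommGroup H] [InnerProductSpace ℂ H]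

/-- The real parts of `z̄ ^ k ⟪x, T ^ k x⟫`, `k ≥ 1`. -/
noncomputable def moment (T : H →L[ℂ] H) (z : ℂ) (x : H) (k : ℕ) : ℝ :=
  (conj z ^ (k + 1) * inner ℂ x ((T ^ (k + 1)) x)).re

/-- The source of all positivity of Fejér sums; it serves both for unitary dilations and for
multiplication by a unimodular scalar. -/
theorem norm_sq_sum_pow_eq_fejerSum {U : H →L[ℂ] H} (hU : ∀ x, ‖U x‖ = ‖x‖) (x : H) (N : ℕ) :
    ‖∑ k ∈ Finset.range N, (U ^ k) x‖ ^ 2 = fejerSum (‖x‖ ^ 2) (moment U 1 x) N := by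
  induction N with
  | zero => simp [fejerSum]
  | succ N ih =>
    have e : ∑ k ∈ Finset.range N, (U ^ (k + 1)) x = U (∑ k ∈ Finset.range N, (U ^ k) x) := by
      rw [map_sum]
      exact Finset.sum_congr rfl fun k _ => by rw [pow_succ']; rfl
    rw [fejerSum_succ, ← ih, Finset.sum_range_succ', pow_zero, one_apply_eq_self,
      add_comm _ x, @norm_add_sq ℂ, e, hU, ← e, inner_sum]
    simp only [moment, map_one, one_pow, one_mul, map_sum, RCLike.re_to_complex]
    ring

/-- The polynomial `N + 2 ∑ (N - 1 - k) z̄ ^ (k + 1) X ^ (k + 1)`. -/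
noncomputable def fejerPolynomial (z : ℂ) (N : ℕ) : Polynomial ℂ :=
  Polynomial.C (N : ℂ) + ∑ k ∈ Finset.range N,
    Polynomial.C ((2 * ((N : ℝ) - 1 - k) : ℝ) * conj z ^ (k + 1)) * Polynomial.X ^ (k + 1)

theorem re_inner_aeval_fejerPolynomial (T : H →L[ℂ] H) (z : ℂ) (x : H) (N : ℕ) :
    (inner ℂ x (Polynomial.aeval T (fejerPolynomial z N) x)).re =
      fejerSum (‖x‖ ^ 2) (moment T z x) N := by
  have e : Polynomial.aeval T (fejerPolynomial z N) x = (N : ℂ) • x + ∑ k ∈ Finset.range N,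
      ((2 * ((N : ℝ) - 1 - k) : ℝ) * conj z ^ (k + 1)) • (T ^ (k + 1)) x := by
    simp only [fejerPolynomial, Polynomial.C_mul', map_add, map_sum, map_smul, Polynomial.aeval_C,
      Polynomial.aeval_X, map_pow, Algebra.algebraMap_eq_smul_one,
      add_apply, sum_apply, smul_apply,
      one_apply_eq_self]
  have hx : inner ℂ x x = ((‖x‖ ^ 2 : ℝ) : ℂ) := by
    rw [inner_self_eq_norm_sq_to_K, Complex.ofReal_pow]; rfl
  rw [e, inner_add_right, inner_sum, inner_smul_right, hx, fejerSum, Finset.mul_sum]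
  simp only [inner_smul_right, Complex.add_re, Complex.re_sum, moment, mul_assoc,
    Complex.re_ofReal_mul]
  congr 1
  rw [← Complex.ofReal_natCast, Complex.re_ofReal_mul, Complex.ofReal_re]

theorem re_eval_fejerPolynomial_nonneg {z : ℂ} (hz : ‖z‖ = 1) (N : ℕ) {w : ℂ} (hw : ‖w‖ ≤ 1) :
    0 ≤ ((fejerPolynomial z N).eval w).re := by
  have bd : ∀ u : ℂ, ‖u‖ = 1 → 0 ≤ ((fejerPolynomial z N).eval u).re := by
    intro u hu
    set V : ℂ →L[ℂ] ℂ := (conj z * u) • ContinuousLinearMap.id ℂ ℂ with hV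
    have hVk : ∀ k : ℕ, (V ^ k) 1 = (conj z * u) ^ k := by
      intro k
      induction k with
      | zero => simp
      | succ k ih => rw [pow_succ', mul_apply_eq_comp, ih, hV]; simp [pow_succ']
    have h := norm_sq_sum_pow_eq_fejerSum (U := V) (fun x => by simp [hV, hz, hu]) (1 : ℂ) N
    have e : ((fejerPolynomial z N).eval u).re = fejerSum (‖(1 : ℂ)‖ ^ 2) (moment V 1 1) N := by
      simp only [fejerPolynomial, Polynomial.eval_add, Polynomial.eval_C, Polynomial.eval_finsetSum,
        Polynomial.eval_mul, Polynomial.eval_pow, Polynomial.eval_X, fejerSum, moment, hVk,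
        Complex.add_re, Complex.re_sum, Finset.mul_sum, mul_assoc, Complex.re_ofReal_mul]
      congr 1
      · simp
      · refine Finset.sum_congr rfl fun k _ => ?_
        simp [mul_pow]
    rw [e, ← h]
    positivity
  -- The maximum principle for `exp (-p)` carries `0 ≤ Re p` from the circle to the disc.
  have hd : Differentiable ℂ fun u => Complex.exp (-(fejerPolynomial z N).eval u) :=
    (Polynomial.differentiable _).neg.cexp
  have := Complex.norm_le_of_forall_mem_frontier_norm_le (U := Metric.ball (0 : ℂ) 1) (C := 1)
    Metric.isBounded_ball hd.diffContOnCl (fun u hu => by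
      rw [frontier_ball _ one_ne_zero, mem_sphere_zero_iff_norm] at hu
      rw [Complex.norm_exp, Real.exp_le_one_iff, Complex.neg_re, neg_nonpos]
      exact bd u hu) (z := w) (by
      rw [closure_ball _ one_ne_zero, mem_closedBall_zero_iff]; exact hw)
  rwa [Complex.norm_exp, Real.exp_le_one_iff, Complex.neg_re, neg_nonpos] at this

end Moments

theorem re_inner_realPart {H : Type*} [NormedAddCommGroup H] [InnerProductSpace ℂ H]
    [CompleteSpace H] (A : H →L[ℂ] H) (x : H) :
    (inner ℂ x ((ℜ A : H →L[ℂ] H) x)).re = (inner ℂ x (A x)).re := by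
  rw [realPart_apply_coe, ContinuousLinearMap.star_eq_adjoint, smul_apply, add_apply,
    ← Complex.coe_smul, inner_smul_right, inner_add_right, ContinuousLinearMap.adjoint_inner_right,
    ← inner_conj_symm (A x) x, Complex.re_ofReal_mul, Complex.add_re, Complex.conj_re]
  ring

/-- Harnack domination, tested on Fejér polynomials. -/
theorem HarnackDominated.exists_fejerSum_le {H : Type u} [NormedAddCommGroup H]
    [InnerProductSpace ℂ H] [CompleteSpace H] {ρ : ℝ} {T₁ T₀ : H →L[ℂ] H}
    (h : HarnackDominated ρ T₁ T₀) :
    ∃ C : ℝ, 0 < C ∧ ∀ z : ℂ, ‖z‖ = 1 → ∀ x N,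
      fejerSum (ρ * ‖x‖ ^ 2) (moment T₁ z x) N ≤
        C * fejerSum (ρ * ‖x‖ ^ 2) (moment T₀ z x) N := by
  obtain ⟨c, hc, h⟩ := h
  refine ⟨c ^ 2, by positivity, fun z hz x N => ?_⟩
  have := h (fejerPolynomial z N) fun w hw => re_eval_fejerPolynomial_nonneg hz N hw
  rw [ContinuousLinearMap.le_def] at this
  have hx := this.re_inner_nonneg_right x
  have h0 : fejerSum (‖x‖ ^ 2) (moment (0 : H →L[ℂ] H) z x) N = N * ‖x‖ ^ 2 := by
    simp [fejerSum, moment]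
  simp only [sub_apply, add_apply,
    smul_apply, inner_sub_right, inner_add_right, inner_smul_right,
    RCLike.re_to_complex, Complex.sub_re, Complex.add_re, Complex.re_ofReal_mul,
    re_inner_realPart, re_inner_aeval_fejerPolynomial, h0] at hx
  -- Adding `(ρ - 1) N ‖x‖ ^ 2` to both sides absorbs the `p(0)` term: the constant coefficient
  -- becomes `ρ ‖x‖ ^ 2` on each side.
  simp only [fejerSum] at hx ⊢
  linarith

/-! ### Powers of the truncated shift -/

/-- Extension of a vector by zero. -/
noncomputable def extendZero {m : ℕ} (x : EuclideanSpace ℂ (Fin m)) (k : ℕ) : ℂ :=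
  if h : k < m then x ⟨k, h⟩ else 0

theorem extendZero_coe {m : ℕ} (x : EuclideanSpace ℂ (Fin m)) (i : Fin m) :
    extendZero x i = x i := by
  simp [extendZero]

theorem extendZero_of_le {m k : ℕ} (x : EuclideanSpace ℂ (Fin m)) (h : m ≤ k) :
    extendZero x k = 0 := by
  simp [extendZero, h]

theorem extendZero_eq_sum {m : ℕ} (x : EuclideanSpace ℂ (Fin m)) (k : ℕ) :
    extendZero x k = ∑ j : Fin m, if k = j then x j else 0 := by
  by_cases h : k < m
  · rw [Finset.sum_eq_single ⟨k, h⟩]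
    · simp [extendZero, h]
    · intro j _ hj
      rw [if_neg]
      rintro rfl
      exact hj rfl
    · simp
  · rw [extendZero_of_le x (by omega), Finset.sum_eq_zero]
    intro j _
    rw [if_neg (by omega)]

theorem truncatedShift_apply {m : ℕ} (b : ℂ) (x : EuclideanSpace ℂ (Fin m)) (i : Fin m) :
    truncatedShift m b x i = b * extendZero x (i + 1) := by
  rw [truncatedShift, Matrix.ofLp_toEuclideanCLM, Matrix.mulVec, dotProduct, extendZero_eq_sum,
    Finset.mul_sum]
  refine Finset.sum_congr rfl fun j _ => ?_
  simp

theorem truncatedShift_pow_apply {m : ℕ} (b : ℂ) (n : ℕ) (x : EuclideanSpace ℂ (Fin m))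
    (i : Fin m) : ((truncatedShift m b ^ n) x) i = b ^ n * extendZero x (i + n) := by
  induction n generalizing x with
  | zero => simp [extendZero_coe]
  | succ n ih =>
    rw [pow_succ, mul_apply_eq_comp, ih, pow_succ, mul_assoc]
    congr 1
    by_cases h : (i : ℕ) + n < m
    · rw [extendZero, dif_pos h, truncatedShift_apply]; rfl
    · rw [extendZero_of_le _ (by omega), extendZero_of_le _ (by omega), mul_zero]

theorem inner_truncatedShift_pow {m : ℕ} (b : ℂ) (n : ℕ) (x y : EuclideanSpace ℂ (Fin m)) :
    inner ℂ y ((truncatedShift m b ^ n) x) =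
      ∑ i : Fin m, ∑ j : Fin m, if (i : ℕ) + n = j then conj (y i) * x j * b ^ n else 0 := by
  rw [PiLp.inner_apply]
  refine Finset.sum_congr rfl fun i _ => ?_
  rw [truncatedShift_pow_apply, extendZero_eq_sum, RCLike.inner_apply, Finset.mul_sum,
    Finset.sum_mul]
  refine Finset.sum_congr rfl fun j _ => ?_
  split_ifs <;> ring

theorem smul_truncatedShift (m : ℕ) (c b : ℂ) :
    c • truncatedShift m b = truncatedShift m (c * b) := by
  rw [truncatedShift, truncatedShift, ← map_smul]
  congr 1
  ext i j
  simp

/-! ### The bilateral shift and the `ρ`-dilation -/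

section BilateralShift

variable {E : Type*} [NormedAddCommGroup E]

/-- Translation of a square-summable two-sided sequence. -/
noncomputable def lpTranslate (s : ℤ) (f : lp (fun _ : ℤ => E) 2) : lp (fun _ : ℤ => E) 2 :=
  ⟨fun k => f (k + s), by
    have h := (memℓp_gen_iff (p := 2) (by simp)).1 (lp.memℓp f)
    exact (memℓp_gen_iff (p := 2) (by simp)).2 (h.comp_injective (add_left_injective s))⟩

theorem lpTranslate_apply (s : ℤ) (f : lp (fun _ : ℤ => E) 2) (k : ℤ) :
    lpTranslate s f k = f (k + s) := rfl

variable [InnerProductSpace ℂ E]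

variable (E) in
/-- The bilateral (backward) shift. -/
noncomputable def bilateralShift : lp (fun _ : ℤ => E) 2 ≃ₗᵢ[ℂ] lp (fun _ : ℤ => E) 2 where
  toFun := lpTranslate 1
  invFun := lpTranslate (-1)
  map_add' f g := rfl
  map_smul' c f := rfl
  left_inv f := by ext k : 2; simp [lpTranslate_apply]
  right_inv f := by ext k : 2; simp [lpTranslate_apply]
  norm_map' f := by
    have h : ∀ g : lp (fun _ : ℤ => E) 2, ‖g‖ ^ 2 = ∑' k, ‖g k‖ ^ 2 := fun g => by
      simpa using lp.norm_rpow_eq_tsum (p := 2) (by simp) g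
    rw [← sq_eq_sq₀ (norm_nonneg _) (norm_nonneg _), h, h]
    exact (Equiv.addRight (1 : ℤ)).tsum_eq fun k => ‖f k‖ ^ 2

theorem bilateralShift_pow_apply (n : ℕ) (f : lp (fun _ : ℤ => E) 2) (k : ℤ) :
    (((bilateralShift E : lp (fun _ : ℤ => E) 2 →L[ℂ] lp (fun _ : ℤ => E) 2) ^ n) f) k =
      f (k + n) := by
  induction n generalizing k with
  | zero => simp
  | succ n ih =>
    rw [pow_succ', mul_apply_eq_comp]
    refine (ih (k + 1)).trans ?_
    exact congrArg (fun l => f l) (by push_cast; ring)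

end BilateralShift

open scoped ComplexOrder MatrixOrder in
theorem Matrix.PosSemidef.exists_inner_eq {m : ℕ} {A : Matrix (Fin m) (Fin m) ℂ}
    (hA : A.PosSemidef) : ∃ g : Fin m → EuclideanSpace ℂ (Fin m),
      ∀ i j, inner ℂ (g i) (g j) = A i j := by
  obtain ⟨B, hB⟩ := CStarAlgebra.nonneg_iff_eq_star_mul_self.1 (Matrix.nonneg_iff_posSemidef.2 hA)
  refine ⟨fun i => WithLp.toLp 2 fun l => B l i, fun i j => ?_⟩
  rw [hB, PiLp.inner_apply, Matrix.mul_apply]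
  refine Finset.sum_congr rfl fun l _ => ?_
  simp [Matrix.star_apply, mul_comm]

open scoped ComplexOrder in
/-- If the kernel matrix is positive semidefinite, the shift has a unitary `ρ`-dilation. -/
theorem isRhoContraction_truncatedShift {m : ℕ} {ρ b : ℝ} (hρ : 0 < ρ)
    (hM : (shiftKernelMatrix m ρ b).PosSemidef) : IsRhoContraction ρ (truncatedShift m b) := by
  have hρ' : (ρ : ℂ) ≠ 0 := by exact_mod_cast hρ.ne'
  -- The kernel divided by `ρ` is the Gram matrix of unit vectors `g i`. Placing `g i` at position
  -- `i` of `ℓ²(ℤ)` makes the images of the basis orthonormal, and shifting by `n` pairs `g i` with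
  -- `g (i + n)`, giving `b ^ n / ρ`.
  obtain ⟨g, hg⟩ := (hM.smul (show (0 : ℝ) ≤ ρ⁻¹ by positivity)).exists_inner_eq
  have hg' : ∀ (n : ℕ) (i j : Fin m), (i : ℕ) + n = j →
      inner ℂ (g i) (g j) = (ρ : ℂ)⁻¹ * if n = 0 then (ρ : ℂ) else (b : ℂ) ^ n := by
    intro n i j h
    have e : inner ℂ (g i) (g j) = (ρ : ℂ)⁻¹ * shiftKernel ρ b i j := by
      rw [hg, Matrix.smul_apply, shiftKernelMatrix, Matrix.of_apply, ← Complex.coe_smul,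
        smul_eq_mul, Complex.ofReal_inv]
    rw [e]
    rcases Nat.eq_zero_or_pos n with rfl | hn
    · rw [if_pos rfl, show (i : ℕ) = j by omega, shiftKernel_self]
    · rw [if_neg hn.ne', shiftKernel_of_lt _ _ (by omega), show (j : ℕ) - i = n by omega]
  let E := EuclideanSpace ℂ (Fin m)
  let K := lp (fun _ : ℤ => E) 2
  let J₀ : E →ₗ[ℂ] K := ∑ i : Fin m, (lp.lsingle (𝕜 := ℂ) (E := fun _ : ℤ => E) 2 (i : ℤ)).comp
    ((LinearMap.toSpanSingleton ℂ E (g i)).comp (EuclideanSpace.proj (𝕜 := ℂ) i).toLinearMap)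
  have hJ₀ : ∀ x, J₀ x = ∑ i : Fin m, lp.single 2 (i : ℤ) (x i • g i) := by
    intro x
    simp only [J₀, LinearMap.sum_apply]
    rfl
  let U : K →L[ℂ] K := (bilateralShift E : K →L[ℂ] K)
  have key : ∀ (n : ℕ) (x y : E), inner ℂ (J₀ y) ((U ^ n) (J₀ x)) =
      (ρ : ℂ)⁻¹ * ∑ i : Fin m, ∑ j : Fin m, if (i : ℕ) + n = j then
        conj (y i) * x j * (if n = 0 then (ρ : ℂ) else (b : ℂ) ^ n) else 0 := by
    intro n x y
    rw [hJ₀ y, sum_inner, Finset.mul_sum]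
    refine Finset.sum_congr rfl fun i _ => ?_
    rw [lp.inner_single_left, bilateralShift_pow_apply, hJ₀ x, lp.coeFn_sum, Finset.sum_apply,
      inner_sum, Finset.mul_sum]
    refine Finset.sum_congr rfl fun j _ => ?_
    rw [lp.single_apply]
    by_cases h : (i : ℕ) + n = j
    · have h' : (i : ℤ) + n = j := by exact_mod_cast h
      rw [if_pos h, h', Pi.single_eq_same, inner_smul_left, inner_smul_right, hg' n i j h]
      ring
    · have h' : (i : ℤ) + n ≠ j := by exact_mod_cast h
      rw [if_neg h, Pi.single_eq_of_ne h', inner_zero_right, mul_zero]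
  have hiso : ∀ y x, inner ℂ (J₀ y) (J₀ x) = inner ℂ y x := by
    intro y x
    have h1 := key 0 x y
    have h2 := inner_truncatedShift_pow 1 0 x y
    rw [pow_zero, one_apply_eq_self] at h1 h2
    rw [h1, h2, Finset.mul_sum]
    refine Finset.sum_congr rfl fun i _ => ?_
    rw [Finset.mul_sum]
    refine Finset.sum_congr rfl fun j _ => ?_
    by_cases h : (i : ℕ) + 0 = j
    · rw [if_pos h, if_pos h, if_pos rfl]; field_simp
    · rw [if_neg h, if_neg h, mul_zero]
  refine ⟨K, inferInstance, inferInstance, inferInstance, J₀.isometryOfInner hiso, U,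
    (Unitary.linearIsometryEquiv.symm (bilateralShift E)).2, fun n hn => ?_⟩
  refine ContinuousLinearMap.ext fun x => ext_inner_left ℂ fun y => ?_
  rw [smul_apply, inner_smul_right, ContinuousLinearMap.comp_apply,
    ContinuousLinearMap.adjoint_inner_right, inner_truncatedShift_pow]
  refine Eq.trans ?_ (congrArg ((ρ : ℂ) * ·) (key n x y)).symm
  rw [mul_inv_cancel_left₀ hρ']
  simp only [if_neg (show n ≠ 0 by omega)]

/-! ### The Toeplitz form and its degeneracy at the normalizing parameter -/

section ShiftForm

open Matrix

/-- The quadratic form of the kernel matrix. -/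
noncomputable def shiftForm (m : ℕ) (ρ b : ℝ) (x : EuclideanSpace ℂ (Fin m)) : ℝ :=
  (star x.ofLp ⬝ᵥ (shiftKernelMatrix m ρ b *ᵥ x.ofLp)).re

theorem isHermitian_shiftKernelMatrix (m : ℕ) (ρ b : ℝ) :
    (shiftKernelMatrix m ρ b).IsHermitian := by
  ext i j
  rw [Matrix.conjTranspose_apply, shiftKernelMatrix, Matrix.of_apply, Matrix.of_apply,
    shiftKernel_comm]
  unfold shiftKernel
  split_ifs <;> simp

open scoped ComplexOrder in
theorem posSemidef_shiftKernelMatrix_iff {m : ℕ} {ρ b : ℝ} :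
    (shiftKernelMatrix m ρ b).PosSemidef ↔ ∀ x, 0 ≤ shiftForm m ρ b x := by
  constructor
  · intro h x
    exact (RCLike.nonneg_iff.1 (h.dotProduct_mulVec_nonneg x.ofLp)).1
  · intro h
    refine .of_dotProduct_mulVec_nonneg (isHermitian_shiftKernelMatrix m ρ b) fun x => ?_
    exact RCLike.nonneg_iff.2 ⟨h (WithLp.toLp 2 x),
      (isHermitian_shiftKernelMatrix m ρ b).im_star_dotProduct_mulVec_self x⟩

theorem shiftForm_eq_sum (m : ℕ) (ρ b : ℝ) (x : EuclideanSpace ℂ (Fin m)) :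
    shiftForm m ρ b x =
    ∑ i : Fin m, ∑ j : Fin m, (conj (x i) * (shiftKernel ρ b i j * x j)).re := by
  simp only [shiftForm, dotProduct, mulVec, Finset.mul_sum, Complex.re_sum]
  rfl

theorem continuous_shiftForm (m : ℕ) (ρ : ℝ) :
    Continuous fun p : ℝ × EuclideanSpace ℂ (Fin m) => shiftForm m ρ p.1 p.2 := by
  simp only [shiftForm_eq_sum]
  refine continuous_finsetSum _ fun i _ => continuous_finsetSum _ fun j _ => ?_
  unfold shiftKernel
  split_ifs <;> fun_prop

theorem shiftForm_smul (m : ℕ) (ρ b r : ℝ) (x : EuclideanSpace ℂ (Fin m)) :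
    shiftForm m ρ b ((r : ℂ) • x) = r ^ 2 * shiftForm m ρ b x := by
  rw [shiftForm_eq_sum, shiftForm_eq_sum, Finset.mul_sum]
  refine Finset.sum_congr rfl fun i _ => ?_
  rw [Finset.mul_sum]
  refine Finset.sum_congr rfl fun j _ => ?_
  rw [← Complex.re_ofReal_mul]
  congr 1
  simp only [PiLp.smul_apply, smul_eq_mul, map_mul, Complex.conj_ofReal]
  push_cast; ring

theorem moment_truncatedShift_eq_zero {m k : ℕ} (b z : ℂ) (x : EuclideanSpace ℂ (Fin m))
    (hk : m ≤ k) : moment (truncatedShift m b) z x k = 0 := by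
  have : (truncatedShift m b ^ (k + 1)) x = 0 := by
    ext i
    rw [truncatedShift_pow_apply, extendZero_of_le _ (by omega), mul_zero]; rfl
  rw [moment, this, inner_zero_right, mul_zero, Complex.zero_re]

theorem shiftForm_eq_moments (m : ℕ) (ρ b : ℝ) (x : EuclideanSpace ℂ (Fin m)) :
    ρ * ‖x‖ ^ 2 + 2 * ∑ k ∈ Finset.range m, moment (truncatedShift m b) 1 x k =
      shiftForm m ρ b x := by
  set t : Fin m → Fin m → ℂ := fun i j =>
    if i < j then conj (x i) * x j * (b : ℂ) ^ ((j : ℕ) - i) else 0 with ht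
  have h1 : ∑ k ∈ Finset.range m, moment (truncatedShift m b) 1 x k = ∑ i, ∑ j, (t i j).re := by
    simp only [moment, map_one, one_pow, one_mul, inner_truncatedShift_pow, Complex.re_sum]
    rw [Finset.sum_comm]
    refine Finset.sum_congr rfl fun i _ => ?_
    rw [Finset.sum_comm]
    refine Finset.sum_congr rfl fun j _ => ?_
    by_cases hij : i < j
    · have hij' : (i : ℕ) < j := hij
      rw [Finset.sum_eq_single ((j : ℕ) - i - 1)]
      · rw [if_pos (by omega)]
        simp only [ht]
        rw [if_pos hij, show (j : ℕ) - i - 1 + 1 = j - i by omega]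
      · intro k _ hk
        rw [if_neg (by omega), Complex.zero_re]
      · intro hk
        exact absurd (Finset.mem_range.2 (by omega)) hk
    · have hij' : ¬ (i : ℕ) < j := hij
      simp only [ht]
      rw [if_neg hij, Complex.zero_re]
      exact Finset.sum_eq_zero fun k _ => by rw [if_neg (by omega), Complex.zero_re]
  have h2 : ρ * ‖x‖ ^ 2 = ∑ i : Fin m, ∑ j : Fin m, if i = j then ρ * ‖x i‖ ^ 2 else 0 := by
    rw [EuclideanSpace.norm_sq_eq, Finset.mul_sum]
    exact Finset.sum_congr rfl fun i _ => by rw [Finset.sum_ite_eq, if_pos (Finset.mem_univ _)]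
  have h3 : 2 * ∑ i, ∑ j, (t i j).re = ∑ i, ∑ j, ((t i j).re + (t j i).re) := by
    simp only [Finset.sum_add_distrib]
    rw [Finset.sum_comm (f := fun i j => (t j i).re)]
    ring
  rw [h1, h2, h3, shiftForm_eq_sum, ← Finset.sum_add_distrib]
  refine Finset.sum_congr rfl fun i _ => ?_
  rw [← Finset.sum_add_distrib]
  refine Finset.sum_congr rfl fun j _ => ?_
  simp only [ht]
  rcases lt_trichotomy i j with h | rfl | h
  · rw [if_neg h.ne, if_pos h, if_neg h.not_gt, shiftKernel_of_lt _ _ h, Complex.zero_re, zero_add,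
      add_zero]
    congr 1; ring
  · rw [if_pos rfl, if_neg (lt_irrefl _), shiftKernel_self, mul_left_comm, Complex.re_ofReal_mul,
      Complex.conj_mul']
    norm_cast
    simp
  · rw [if_neg h.ne', if_pos h, if_neg h.not_gt, shiftKernel_comm, shiftKernel_of_lt _ _ h,
      Complex.zero_re, zero_add, zero_add, ← Complex.conj_re]
    congr 1
    simp only [map_mul, map_pow, Complex.conj_conj, Complex.conj_ofReal]
    ring

theorem tendsto_fejerSum_truncatedShift (m : ℕ) (ρ b : ℝ) (x : EuclideanSpace ℂ (Fin m)) :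
    Tendsto (fun N : ℕ => fejerSum (ρ * ‖x‖ ^ 2) (moment (truncatedShift m b) 1 x) N / N) atTop
      (𝓝 (shiftForm m ρ b x)) := by
  rw [← shiftForm_eq_moments]
  exact tendsto_fejerSum_div _ fun k hk => moment_truncatedShift_eq_zero _ _ x hk

/-- Through the dilation, the sum is `ρ` times the squared norm of `∑ U ^ k (J x)`. -/
theorem IsRhoContraction.fejerSum_nonneg {H : Type u} [NormedAddCommGroup H]
    [InnerProductSpace ℂ H] [CompleteSpace H] {ρ : ℝ} (hρ : 0 ≤ ρ) {T : H →L[ℂ] H}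
    (h : IsRhoContraction ρ T) (x : H) (N : ℕ) :
    0 ≤ fejerSum (ρ * ‖x‖ ^ 2) (moment T 1 x) N := by
  obtain ⟨K, _, _, _, J, U, hU, hT⟩ := h
  have e : moment T 1 x = fun k => ρ * moment U 1 (J x) k := by
    ext k
    rw [moment, moment, hT (k + 1) (by omega), _root_.smul_apply, inner_smul_right,
      ContinuousLinearMap.comp_apply, ContinuousLinearMap.adjoint_inner_right, mul_left_comm,
      Complex.re_ofReal_mul]
    rfl
  rw [e, fejerSum_mul, ← J.norm_map x,
    ← norm_sq_sum_pow_eq_fejerSum (U.norm_map_of_mem_unitary hU)]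
  positivity

open scoped ComplexOrder in
theorem isRhoContraction_truncatedShift_iff {m : ℕ} {ρ b : ℝ} (hρ : 0 < ρ) :
    IsRhoContraction ρ (truncatedShift m b) ↔ ∀ x, 0 ≤ shiftForm m ρ b x := by
  constructor
  · intro h x
    exact ge_of_tendsto' (tendsto_fejerSum_truncatedShift m ρ b x) fun N =>
      div_nonneg (h.fejerSum_nonneg hρ.le x N) N.cast_nonneg
  · intro h
    exact isRhoContraction_truncatedShift hρ (posSemidef_shiftKernelMatrix_iff.2 h)

theorem shiftForm_one (m : ℕ) (ρ : ℝ) (x : EuclideanSpace ℂ (Fin m)) :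
    shiftForm m ρ 1 x = (ρ - 1) * ‖x‖ ^ 2 + ‖∑ i, x i‖ ^ 2 := by
  have h2 : (ρ - 1) * ‖x‖ ^ 2 = ∑ i : Fin m, ∑ j : Fin m, if i = j then (ρ - 1) * ‖x i‖ ^ 2 else 0 := by
    rw [EuclideanSpace.norm_sq_eq, Finset.mul_sum]
    exact Finset.sum_congr rfl fun i _ => by rw [Finset.sum_ite_eq, if_pos (Finset.mem_univ _)]
  have h3 : ‖∑ i, x i‖ ^ 2 = ∑ i, ∑ j, (conj (x i) * x j).re := by
    have : ((‖∑ i, x i‖ ^ 2 : ℝ) : ℂ) = conj (∑ i, x i) * ∑ i, x i := by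
      rw [Complex.conj_mul']; norm_cast
    rw [← Complex.ofReal_re (‖∑ i, x i‖ ^ 2), this, map_sum, Finset.sum_mul_sum]
    simp only [Complex.re_sum]
  rw [h2, h3, shiftForm_eq_sum, ← Finset.sum_add_distrib]
  refine Finset.sum_congr rfl fun i _ => ?_
  rw [← Finset.sum_add_distrib]
  refine Finset.sum_congr rfl fun j _ => ?_
  by_cases h : i = j
  · subst h
    rw [if_pos rfl, shiftKernel_self, mul_left_comm, Complex.re_ofReal_mul, Complex.conj_mul']
    norm_cast
    simp; ring
  · rw [if_neg h, shiftKernel, if_neg (by omega)]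
    simp

theorem le_of_shiftForm_nonneg {m : ℕ} {ρ b : ℝ} (hm : 2 ≤ m) (h : ∀ x, 0 ≤ shiftForm m ρ b x) :
    b ≤ ρ := by
  obtain ⟨n, rfl⟩ : ∃ n, m = n + 2 := ⟨m - 2, by omega⟩
  -- On the difference of the first two basis vectors the form equals `2 (ρ - b)`.
  have hx := h (WithLp.toLp 2 fun i => if (i : ℕ) = 0 then 1 else if (i : ℕ) = 1 then -1 else 0)
  have hs : ∀ f : Fin (n + 2) → ℝ, (∀ i : Fin (n + 2), 2 ≤ (i : ℕ) → f i = 0) →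
      ∑ i, f i = f 0 + f 1 := by
    intro f hf
    rw [Fin.sum_univ_succ, Fin.sum_univ_succ, Finset.sum_eq_zero, add_zero]
    · rfl
    · intro i _
      exact hf _ (by simp)
  have h0 : ∀ i : Fin (n + 2), 2 ≤ (i : ℕ) → ¬ (i : ℕ) = 0 ∧ ¬ (i : ℕ) = 1 := by
    intro i hi; omega
  rw [shiftForm_eq_sum, hs, hs, hs] at hx
  · simp [shiftKernel] at hx
    linarith
  · intro i hi; simp [h0 i hi]
  · intro i hi; simp [h0 i hi]
  · intro i hi; simp [h0 i hi]

/-- The value at `b = 1` puts `1` in `G`, and `b ≤ ρ` keeps `G` away from `0`. Nonnegativity passes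
to the infimum by continuity; were the form definite there, compactness of the sphere would allow a
smaller `γ`. -/
theorem shiftForm_inv_sInf {m : ℕ} {ρ : ℝ} (hm : 2 ≤ m) (hρ : 1 < ρ) {G : Set ℝ}
    (mem : ∀ γ, γ ∈ G ↔ 0 < γ ∧ ∀ x, 0 ≤ shiftForm m ρ γ⁻¹ x) :
    0 < sInf G ∧ (∀ x, 0 ≤ shiftForm m ρ (sInf G)⁻¹ x) ∧ ∃ x ≠ 0, shiftForm m ρ (sInf G)⁻¹ x = 0 := by
  have hne : G.Nonempty := by
    refine ⟨1, (mem 1).2 ⟨one_pos, fun x => ?_⟩⟩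
    rw [inv_one, shiftForm_one]
    have : 0 < ρ - 1 := by linarith
    positivity
  have hlow : ∀ γ ∈ G, ρ⁻¹ ≤ γ := fun γ hγ =>
    inv_le_of_inv_le₀ ((mem γ).1 hγ).1 (le_of_shiftForm_nonneg hm ((mem γ).1 hγ).2)
  have hw0 : 0 < sInf G := lt_of_lt_of_le (by positivity) (le_csInf hne hlow)
  have hcl : sInf G ∈ closure G := csInf_mem_closure hne ⟨ρ⁻¹, hlow⟩
  have hle : ∀ γ ∈ G, sInf G ≤ γ := fun γ hγ => csInf_le ⟨ρ⁻¹, hlow⟩ hγ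
  generalize sInf G = w at hw0 hcl hle ⊢
  have hcont : ∀ x, ContinuousAt (fun γ : ℝ => shiftForm m ρ γ⁻¹ x) w := fun x =>
    ((continuous_shiftForm m ρ).comp (Continuous.prodMk_left x)).continuousAt.comp
      (continuousAt_inv₀ hw0.ne')
  have hnn : ∀ x, 0 ≤ shiftForm m ρ w⁻¹ x := by
    intro x
    have : (𝓝[G] w).NeBot := mem_closure_iff_nhdsWithin_neBot.1 hcl
    refine ge_of_tendsto (x := 𝓝[G] w) ((hcont x).mono_left nhdsWithin_le_nhds) ?_
    filter_upwards [self_mem_nhdsWithin] with γ hγ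
    exact ((mem γ).1 hγ).2 x
  refine ⟨hw0, hnn, ?_⟩
  by_contra! hpos
  have hev : ∀ᶠ γ in 𝓝 w, ∀ x ∈ Metric.sphere (0 : EuclideanSpace ℂ (Fin m)) 1,
      0 < shiftForm m ρ γ⁻¹ x := by
    refine (isCompact_sphere _ _).eventually_forall_of_forall_eventually fun x hx => ?_
    have hx0 : x ≠ 0 := by
      rintro rfl
      simp at hx
    have hi : ContinuousAt (fun p : ℝ × EuclideanSpace ℂ (Fin m) => (p.1⁻¹, p.2)) (w, x) :=
      (continuousAt_fst.inv₀ hw0.ne').prodMk continuousAt_snd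
    have hc := (continuous_shiftForm m ρ).continuousAt.comp hi
    exact hc.eventually (lt_mem_nhds (lt_of_le_of_ne (hnn x) (hpos x hx0).symm))
  obtain ⟨γ, hγ, hγw, hγ0⟩ := ((hev.filter_mono nhdsWithin_le_nhds).and
    ((self_mem_nhdsWithin : Set.Iio w ∈ 𝓝[<] w) |> fun h =>
      Filter.Eventually.and h (nhdsWithin_le_nhds (lt_mem_nhds hw0)))).exists
  have hγG : γ ∈ G := by
    refine (mem γ).2 ⟨hγ0, fun x => ?_⟩
    by_cases hx : x = 0
    · simp [hx, shiftForm]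
    have hn : 0 < ‖x‖ := norm_pos_iff.2 hx
    have e : x = ((‖x‖ : ℝ) : ℂ) • (((‖x‖⁻¹ : ℝ) : ℂ) • x) := by
      rw [smul_smul, ← Complex.ofReal_mul, mul_inv_cancel₀ hn.ne', Complex.ofReal_one, one_smul]
    rw [e, shiftForm_smul]
    refine mul_nonneg (sq_nonneg _) (hγ _ ?_).le
    rw [mem_sphere_zero_iff_norm, norm_smul, Complex.norm_real, norm_inv, norm_norm,
      inv_mul_cancel₀ hn.ne']
  exact absurd (hle γ hγG) (not_le.2 hγw)

/-- At the normalizing parameter the form is nonnegative and degenerate. -/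
theorem shiftForm_inv_rhoNumericalRadius {m : ℕ} {ρ : ℝ} (hm : 2 ≤ m) (hρ : 1 < ρ) :
    0 < rhoNumericalRadius ρ (truncatedShift m 1) ∧
      (∀ x, 0 ≤ shiftForm m ρ (rhoNumericalRadius ρ (truncatedShift m 1))⁻¹ x) ∧
      ∃ x ≠ 0, shiftForm m ρ (rhoNumericalRadius ρ (truncatedShift m 1))⁻¹ x = 0 := by
  rw [rhoNumericalRadius]
  refine shiftForm_inv_sInf hm hρ fun γ => ?_
  rw [Set.mem_ofPred_eq, smul_truncatedShift, mul_one,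
    isRhoContraction_truncatedShift_iff (by linarith)]

end ShiftForm

/-! ### Rotations of the circle and reducing subspaces -/

/-- The diagonal operator with entries `z ^ i`. -/
noncomputable def twist {m : ℕ} (z : ℂ) (x : EuclideanSpace ℂ (Fin m)) :
    EuclideanSpace ℂ (Fin m) :=
  WithLp.toLp 2 fun i => z ^ (i : ℕ) * x i

theorem twist_apply {m : ℕ} (z : ℂ) (x : EuclideanSpace ℂ (Fin m)) (i : Fin m) :
    twist z x i = z ^ (i : ℕ) * x i := rfl

theorem conj_mul_self_of_norm_eq_one {z : ℂ} (hz : ‖z‖ = 1) : conj z * z = 1 := by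
  rw [Complex.conj_mul', hz]; simp

theorem twist_twist_conj {m : ℕ} {z : ℂ} (hz : ‖z‖ = 1) (x : EuclideanSpace ℂ (Fin m)) :
    twist z (twist (conj z) x) = x := by
  ext i
  rw [twist_apply, twist_apply, ← mul_assoc, ← mul_pow, mul_comm z,
    conj_mul_self_of_norm_eq_one hz, one_pow, one_mul]

theorem twist_smul {m : ℕ} (z c : ℂ) (x : EuclideanSpace ℂ (Fin m)) :
    twist z (c • x) = c • twist z x := by
  ext i
  simp only [twist_apply, PiLp.smul_apply, smul_eq_mul]
  ring

theorem norm_sq_twist {m : ℕ} {z : ℂ} (hz : ‖z‖ = 1) (x : EuclideanSpace ℂ (Fin m)) :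
    ‖twist z x‖ ^ 2 = ‖x‖ ^ 2 := by
  simp [EuclideanSpace.norm_sq_eq, twist_apply, hz]

/-- Conjugating the shift by the diagonal unitary multiplies it by `z`, which cancels the `conj z`
in the moments. -/
theorem moment_twist {m : ℕ} (b : ℂ) {z : ℂ} (hz : ‖z‖ = 1) (x : EuclideanSpace ℂ (Fin m)) :
    moment (truncatedShift m b) z (twist z x) = moment (truncatedShift m b) 1 x := by
  ext k
  rw [moment, moment, map_one, one_pow, one_mul, inner_truncatedShift_pow,
    inner_truncatedShift_pow, Finset.mul_sum]
  congr 1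
  refine Finset.sum_congr rfl fun i _ => ?_
  rw [Finset.mul_sum]
  refine Finset.sum_congr rfl fun j _ => ?_
  split_ifs with h
  · have e := conj_mul_self_of_norm_eq_one hz
    have e1 : (conj z * z) ^ (k + 1) * (conj z * z) ^ (i : ℕ) = 1 := by rw [e]; simp
    rw [twist_apply, twist_apply, ← h, map_mul, map_pow, pow_add z]
    calc _ = ((conj z * z) ^ (k + 1) * (conj z * z) ^ (i : ℕ)) *
          (conj (x i) * x j * b ^ (k + 1)) := by rw [mul_pow, mul_pow]; ring
      _ = _ := by rw [e1, one_mul]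
  · exact mul_zero _

theorem fejerSum_twist {m : ℕ} (ρ : ℝ) (b : ℂ) {z : ℂ} (hz : ‖z‖ = 1)
    (x : EuclideanSpace ℂ (Fin m)) (N : ℕ) :
    fejerSum (ρ * ‖twist z x‖ ^ 2) (moment (truncatedShift m b) z (twist z x)) N =
      fejerSum (ρ * ‖x‖ ^ 2) (moment (truncatedShift m b) 1 x) N := by
  rw [norm_sq_twist hz, moment_twist b hz]

theorem fejerSum_add_of_mem_orthogonal {H : Type*} [NormedAddCommGroup H] [InnerProductSpace ℂ H]
    {T : H →L[ℂ] H} {E : Submodule ℂ H} (hE : ∀ x ∈ E, T x ∈ E) (hE' : ∀ x ∈ Eᗮ, T x ∈ Eᗮ)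
    (ρ : ℝ) (z : ℂ) {p q : H} (hp : p ∈ E) (hq : q ∈ Eᗮ) (N : ℕ) :
    fejerSum (ρ * ‖p + q‖ ^ 2) (moment T z (p + q)) N =
      fejerSum (ρ * ‖p‖ ^ 2) (moment T z p) N + fejerSum (ρ * ‖q‖ ^ 2) (moment T z q) N := by
  have hpow : ∀ F : Submodule ℂ H, (∀ x ∈ F, T x ∈ F) → ∀ (k : ℕ), ∀ x ∈ F, (T ^ k) x ∈ F := by
    intro F hF k
    induction k with
    | zero => exact fun x hx => hx
    | succ k ih =>
      intro x hx
      rw [pow_succ, mul_apply_eq_comp]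
      exact ih _ (hF x hx)
  have hm : ∀ k, moment T z (p + q) k = moment T z p k + moment T z q k := by
    intro k
    rw [moment, map_add, inner_add_left, inner_add_right, inner_add_right,
      Submodule.inner_right_of_mem_orthogonal hp (hpow _ hE' (k + 1) q hq),
      Submodule.inner_left_of_mem_orthogonal (hpow _ hE (k + 1) p hp) hq, add_zero, zero_add,
      mul_add, Complex.add_re]
    rfl
  have hn : ‖p + q‖ ^ 2 = ‖p‖ ^ 2 + ‖q‖ ^ 2 := by
    rw [@norm_add_sq ℂ, Submodule.inner_right_of_mem_orthogonal hp hq]; simp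
  simp only [fejerSum, hm, hn, mul_add, Finset.sum_add_distrib]
  ring

/-- A subspace containing `twist z x` for infinitely many `z` is dense if `x` has no zero entry. -/
theorem orthogonal_eq_bot_of_infinite_twist_mem {m : ℕ} {x : EuclideanSpace ℂ (Fin m)}
    (hx : ∀ i, x i ≠ 0) {F : Submodule ℂ (EuclideanSpace ℂ (Fin m))}
    (h : {z : ℂ | twist z x ∈ F}.Infinite) : Fᗮ = ⊥ := by
  rw [Submodule.eq_bot_iff]
  intro w hw
  -- `P z` is the inner product of `w` with `twist z x`, a polynomial in `z` with infinitely many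
  -- roots.
  set P : Polynomial ℂ := ∑ i : Fin m, Polynomial.C (conj (w i) * x i) * Polynomial.X ^ (i : ℕ)
    with hP
  have hP0 : P = 0 := by
    refine Polynomial.eq_zero_of_infinite_isRoot P (h.mono fun z hz => ?_)
    change P.IsRoot z
    rw [Polynomial.IsRoot.def, ← Submodule.inner_left_of_mem_orthogonal hz hw, PiLp.inner_apply, hP,
      Polynomial.eval_finsetSum]
    refine Finset.sum_congr rfl fun i _ => ?_
    simp only [Polynomial.eval_mul, Polynomial.eval_C, Polynomial.eval_pow, Polynomial.eval_X,
      twist_apply, RCLike.inner_apply]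
    ring
  ext i
  have hc : P.coeff i = conj (w i) * x i := by
    rw [hP, Polynomial.finsetSum_coeff, Finset.sum_eq_single i]
    · rw [Polynomial.coeff_C_mul_X_pow, if_pos rfl]
    · intro j _ hj
      rw [Polynomial.coeff_C_mul_X_pow, if_neg]
      exact fun h => hj (Fin.ext h.symm)
    · simp
  rw [hP0, Polynomial.coeff_zero, eq_comm, mul_eq_zero, or_iff_left (hx i)] at hc
  simpa using hc

theorem infinite_norm_eq_one : {z : ℂ | ‖z‖ = 1}.Infinite := by
  have h : IsPreconnected (Metric.sphere (0 : ℂ) 1) :=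
    isPreconnected_sphere (by rw [Complex.rank_real_complex]; norm_num) 0 1
  have e : Metric.sphere (0 : ℂ) 1 = {z : ℂ | ‖z‖ = 1} := by ext z; simp
  rw [← e]
  refine h.infinite_of_nontrivial ⟨1, by simp, -1, by simp, ?_⟩
  norm_num

open scoped ComplexOrder in
theorem isShiftNull_of_shiftForm_eq_zero {m : ℕ} {ρ b : ℝ} (h : ∀ x, 0 ≤ shiftForm m ρ b x)
    {x : EuclideanSpace ℂ (Fin m)} (hx : shiftForm m ρ b x = 0) :
    IsShiftNull ρ b m (extendZero x) := by
  have hM := posSemidef_shiftKernelMatrix_iff.2 h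
  rw [isShiftNull_iff]
  simp only [extendZero_coe]
  refine (hM.dotProduct_mulVec_zero_iff _).1 (Complex.ext hx ?_)
  exact (isHermitian_shiftKernelMatrix m ρ b).im_star_dotProduct_mulVec_self x.ofLp

/-- Null vectors of the form are determined by their first entry. -/
theorem eq_smul_of_shiftForm_eq_zero {m : ℕ} [NeZero m] {ρ b : ℝ} (hρ : ρ ≠ 1) (hb : b ≠ 0)
    (h : ∀ x, 0 ≤ shiftForm m ρ b x) {x y : EuclideanSpace ℂ (Fin m)}
    (hx : shiftForm m ρ b x = 0) (hx0 : x 0 ≠ 0) (hy : shiftForm m ρ b y = 0) :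
    y = (y 0 / x 0) • x := by
  have nx := isShiftNull_of_shiftForm_eq_zero h hx
  have ny := isShiftNull_of_shiftForm_eq_zero h hy
  set c := y 0 / x 0 with hc
  have hn : IsShiftNull ρ b m fun k => extendZero y k - c * extendZero x k := by
    intro i hi
    have e1 := nx i hi
    have e2 := ny i hi
    simp only [mul_sub, Finset.sum_sub_distrib, e2, mul_left_comm _ c, ← Finset.mul_sum, e1]
    simp
  have h0 : extendZero y 0 - c * extendZero x 0 = 0 := by
    have hy0 : extendZero y 0 = y 0 := extendZero_coe y 0
    have hx0' : extendZero x 0 = x 0 := extendZero_coe x 0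
    rw [hy0, hx0', hc]
    field_simp
    ring
  have hz := hn.eq_zero_of_zero (by exact_mod_cast hρ) (by exact_mod_cast hb) h0
  ext i
  have := hz i i.2
  rw [extendZero_coe, extendZero_coe, sub_eq_zero] at this
  rw [this, PiLp.smul_apply, smul_eq_mul]

/-- A subspace reducing an operator Harnack equivalent to a degenerate shift contains each twisted
null vector of the shift, or is orthogonal to it. -/
theorem HarnackEquivalent.twist_mem_or_mem_orthogonal {m : ℕ} [NeZero m] {ρ b : ℝ} (hρ : 1 < ρ)
    (hb : b ≠ 0) (h : ∀ x, 0 ≤ shiftForm m ρ b x)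
    {T : EuclideanSpace ℂ (Fin m) →L[ℂ] EuclideanSpace ℂ (Fin m)}
    (hT : HarnackEquivalent ρ T (truncatedShift m b)) {x : EuclideanSpace ℂ (Fin m)}
    (hx : shiftForm m ρ b x = 0) (hx0 : x 0 ≠ 0) {E : Submodule ℂ (EuclideanSpace ℂ (Fin m))}
    (hE : ∀ y ∈ E, T y ∈ E) (hE' : ∀ y ∈ Eᗮ, T y ∈ Eᗮ) {z : ℂ} (hz : ‖z‖ = 1) :
    twist z x ∈ E ∨ twist z x ∈ Eᗮ := by
  obtain ⟨⟨C, hC, h1⟩, ⟨C', hC', h2⟩⟩ :=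
    And.intro hT.1.exists_fejerSum_le hT.2.exists_fejerSum_le
  have hS := (isRhoContraction_truncatedShift_iff (by linarith)).2 h
  obtain ⟨p, hp, q, hq, hpq⟩ := E.exists_add_mem_mem_orthogonal (twist z x)
  -- Positivity for `T` is inherited from the shift through domination.
  have hq0 : ∀ N, 0 ≤ fejerSum (ρ * ‖q‖ ^ 2) (moment T z q) N := by
    intro N
    have e := h2 z hz q N
    have e' := hS.fejerSum_nonneg (by linarith) (twist (conj z) q) N
    rw [← fejerSum_twist ρ b hz, twist_twist_conj hz] at e'
    exact nonneg_of_mul_nonneg_right (e'.trans e) hC'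
  -- Chain, all at `z`: `S` at `p` ≤ `C'` times `T` at `p` ≤ `C'` times `T` at `p + q` ≤ `C' C`
  -- times `S` at `p + q`. The last, divided by `N`, tends to zero.
  have hle : ∀ N, fejerSum (ρ * ‖twist (conj z) p‖ ^ 2)
      (moment (truncatedShift m b) 1 (twist (conj z) p)) N ≤
      C' * C * fejerSum (ρ * ‖x‖ ^ 2) (moment (truncatedShift m b) 1 x) N := by
    intro N
    rw [← fejerSum_twist ρ b hz, twist_twist_conj hz, ← fejerSum_twist ρ b hz x]
    refine (h2 z hz p N).trans ?_
    rw [mul_assoc]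
    refine mul_le_mul_of_nonneg_left (le_trans ?_ (h1 z hz (twist z x) N)) hC'.le
    rw [hpq, fejerSum_add_of_mem_orthogonal hE hE' ρ z hp hq]
    linarith [hq0 N]
  have hlim : shiftForm m ρ b (twist (conj z) p) ≤ C' * C * shiftForm m ρ b x := by
    refine le_of_tendsto_of_tendsto' (tendsto_fejerSum_truncatedShift m ρ b _)
      ((tendsto_fejerSum_truncatedShift m ρ b x).const_mul (C' * C)) fun N => ?_
    rw [← mul_div_assoc]
    exact div_le_div_of_nonneg_right (hle N) N.cast_nonneg
  rw [hx, mul_zero] at hlim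
  have hpx := eq_smul_of_shiftForm_eq_zero hρ.ne' hb h hx hx0 (le_antisymm hlim (h _))
  set c := (twist (conj z) p) 0 / x 0
  have hpc : p = c • twist z x := by
    rw [← twist_smul, ← hpx, twist_twist_conj hz]
  by_cases hc : c = 0
  · right
    rw [hpq, hpc, hc, zero_smul, zero_add]
    exact hq
  · left
    have : twist z x = c⁻¹ • p := by rw [hpc, smul_smul, inv_mul_cancel₀ hc, one_smul]
    rw [this]
    exact E.smul_mem _ hp

theorem proposition3p7 (ρ : ℝ) (hρ : 1 < ρ) (n : ℕ) (hn : Even (n + 1))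
    (T : EuclideanSpace ℂ (Fin (n + 1)) →L[ℂ] EuclideanSpace ℂ (Fin (n + 1)))
    (hT : IsRhoContraction ρ T)
    (hTS : HarnackEquivalent ρ T (normalizedTruncatedShift ρ (n + 1))) :
    IsIrreducibleOperator T := by
  have hm : 2 ≤ n + 1 := by
    obtain ⟨k, hk⟩ := hn
    omega
  obtain ⟨hw, hpos, x, hx0, hx⟩ := shiftForm_inv_rhoNumericalRadius hm hρ
  have hb := (inv_pos.2 hw).ne'
  intro E _ hE hE'
  have hne : ∀ i, x i ≠ 0 := by
    obtain ⟨j, hj⟩ : ∃ j, x j ≠ 0 := by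
      by_contra! hc
      exact hx0 (by ext i; simpa using hc i)
    intro i
    have := (isShiftNull_of_shiftForm_eq_zero hpos hx).ne_zero hρ.ne' hb
      (posSemidef_shiftKernelMatrix_iff.2 hpos) hn ⟨j, j.2, by rwa [extendZero_coe]⟩ i i.2
    rwa [extendZero_coe] at this
  have hdich : {z : ℂ | ‖z‖ = 1} ⊆ {z | twist z x ∈ E} ∪ {z | twist z x ∈ Eᗮ} := fun z hz =>
    HarnackEquivalent.twist_mem_or_mem_orthogonal hρ hb hpos hTS hx (hne 0) hE hE' hz
  rcases Set.infinite_union.1 (infinite_norm_eq_one.mono hdich) with h | h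
  · exact Or.inr (Submodule.orthogonal_eq_bot_iff.1 (orthogonal_eq_bot_of_infinite_twist_mem hne h))
  · exact Or.inl (eq_bot_iff.2 ((Submodule.le_orthogonal_orthogonal E).trans
      (orthogonal_eq_bot_of_infinite_twist_mem hne h).le))
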